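/- A finite distributionally robust Markov game consists of a finite set $\mathcal N$ of agents, a finite state space $\mathcal S$, finite action sets $\mathcal A_i$ with $\mathcal A=\prod_{i\in\mathcal N}\mathcal A_i$, rewards $r_i:\mathcal S\times\mathcal A\to[0,1]$, and a nonempty $(s,a)$-rectangular uncertainty set $\mathcal P=\prod_{(s,a)\in\mathcal S\times\mathcal A}\mathcal P_s^a$ with $\mathcal P_s^a\subseteq\Delta(\mathcal S)$. A joint policy is a product policy $\pi=(\pi_i)_{i\in\mathcal N}$ of stationary policies $\pi_i:\mathcal S\to\Delta(\mathcal A_i)$. For $\gamma\in[0,1)$, a kernel $\mathsf P\in\mathcal P$, an agent $i$ and an initial state $s$ put $$V^{\pi}_{\gamma,\mathsf P,i}(s)=\mathbb E_{\pi,\mathsf P}\Big[\sum_{t\ge 0}\gamma^t r_i(s_t,a_t)\,\Big|\,s_0=s\Big],\qquad g^{\pi}_{\mathsf P,i}(s)=\liminf_{n\to\infty}\mathbb E_{\pi,\mathsf P}\Big[\frac1n\sum_{t=0}^{n-1}r_i(s_t,a_t)\,\Big|\,s_0=s\Big],$$ and define the robust values $V^{\pi}_{\gamma,\mathcal P,i}(s)=\inf_{\mathsf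 P\in\mathcal P}V^{\pi}_{\gamma,\mathsf P,i}(s)$ and $g^{\pi}_{\mathcal P,i}(s)=\inf_{\mathsf P\in\mathcal P}g^{\pi}_{\mathsf P,i}(s)$. For $\epsilon\ge 0$, a joint policy $\pi$ is an $\epsilon$-Nash equilibrium of the $\gamma$-discounted robust game if $V^{(\pi_{-i},\mu_i)}_{\gamma,\mathcal P,i}(s)\le V^{\pi}_{\gamma,\mathcal P,i}(s)+\epsilon$ for all agents $i$, all stationary policies $\mu_i$ of agent $i$ and all states $s$, and an $\epsilon$-Nash equilibrium of the average-reward robust game if the same holds with $g_{\mathcal P,i}$ in place of $V_{\gamma,\mathcal P,i}$; a Nash equilibrium is a $0$-Nash equilibrium. Assume that $\mathcal P$ is compact and convex and that for every deterministic joint policy $\pi$ and every $\mathsf P\in\mathcal P$ the induced Markov chain on $\mathcal S$ is irreducible. Then: (1) Let $\gamma_t\in[0,1)$ with $\gamma_t\to1$, and let $\pi_t$ be a Nash equilibrium of the $\gamma_t$-discounted robust game for every $t$. If $\pi_t\to\pi$, then $\pi$ is a Nash equilibrium of the average-reward robust game. (2) For every $\epsilon>0$ there is a discount factor $\gamma\in[0,1)$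 such that every $\epsilon$-Nash equilibrium of the $\gamma$-discounted robust game is a $C\epsilon$-Nash equilibrium of the average-reward robust game, where $C>0$ is an absolute constant (it depends neither on $\epsilon$ nor on the game). -/

import Mathlib

open Filter Topology

noncomputable section

/-- A finite distributionally robust Markov game with set of agents `ι`, state space `S` and action
sets `A i`. For every state and joint action there is a set of possible next-state distributions,
chosen independently over all pairs of a state and a joint action. -/
structure RobustMarkovGame (ι S : Type*) (A : ι → Type*) [Fintype S] where
  /-- `reward i s a` is the reward of agent `i` in state `s` under the joint action `a`. -/
  reward : ι → S → (∀ i, A i) → ℝ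
  reward_mem : ∀ i s a, reward i s a ∈ Set.Icc (0 : ℝ) 1
  /-- `uncertainty s a` is the set of possible next-state distributions after `a` in `s`. -/
  uncertainty : S → (∀ i, A i) → Set (S → ℝ)
  uncertainty_subset : ∀ s a, uncertainty s a ⊆ stdSimplex ℝ S
  uncertainty_nonempty : ∀ s a, (uncertainty s a).Nonempty

/-- Stationary policies of one agent: `μ s a` is the probability of the action `a` in state `s`. -/
abbrev StationaryPolicy (S B : Type*) [Fintype B] : Type _ := S → stdSimplex ℝ B

/-- Product policies: one stationary policy for each agent, with the product topology. -/
abbrev JointPolicy {ι : Type*} (S : Type*) (A : ι → Type*) [∀ i, Fintype (A i)] : Type _ :=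
  ∀ i, StationaryPolicy S (A i)

namespace JointPolicy

variable {ι S : Type*} {A : ι → Type*} [∀ i, Fintype (A i)]

/-- The probability of the joint action `a` in state `s`: the agents randomize independently. -/
def prob [Fintype ι] (π : JointPolicy S A) (s : S) (a : ∀ i, A i) : ℝ :=
  ∏ i, (π i s : A i → ℝ) (a i)

/-- In every state every agent plays some action with probability one. -/
def IsDeterministic (π : JointPolicy S A) : Prop :=
  ∀ i s, ∃ a : A i, (π i s : A i → ℝ) a = 1

end JointPolicy

namespace RobustMarkovGame

variable {ι S : Type*} {A : ι → Type*}
  [Fintype ι] [DecidableEq ι] [Fintype S] [DecidableEq S] [∀ i, Fintype (A i)]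

/-- The rectangular set of transition kernels; `P s a s'` is the probability of moving to `s'`. -/
def kernels (G : RobustMarkovGame ι S A) : Set (S → (∀ i, A i) → S → ℝ) :=
  {P | ∀ s a, P s a ∈ G.uncertainty s a}

/-- The transition matrix on the states that the joint policy `π` induces from the kernel `P`. -/
def transitionMatrix (P : S → (∀ i, A i) → S → ℝ) (π : JointPolicy S A) : Matrix S S ℝ :=
  Matrix.of fun s s' => ∑ a, π.prob s a * P s a s'

/-- Expected one-step reward of agent `i` in state `s` under the joint policy `π`. -/
def policyReward (G : RobustMarkovGame ι S A) (π : JointPolicy S A) (i : ι) (s : S) : ℝ :=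
  ∑ a, π.prob s a * G.reward i s a

/-- The expectation, under the kernel `P` and the joint policy `π`, of the reward of agent `i` at
time `t` when the initial state is `s`; the law of the state at time `t` is row `s` of the `t`-th
power of the transition matrix. -/
def expectedReward (G : RobustMarkovGame ι S A) (P : S → (∀ i, A i) → S → ℝ)
    (π : JointPolicy S A) (i : ι) (t : ℕ) (s : S) : ℝ :=
  ∑ s', (transitionMatrix P π ^ t) s s' * G.policyReward π i s'

/-- The `γ`-discounted value of agent `i` under the fixed kernel `P`. -/
def discountedValue (G : RobustMarkovGame ι S A) (γ : ℝ) (P : S → (∀ i, A i) → S → ℝ)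
    (π : JointPolicy S A) (i : ι) (s : S) : ℝ :=
  ∑' t : ℕ, γ ^ t * G.expectedReward P π i t s

/-- The average reward of agent `i` under the fixed kernel `P`. -/
def averageReward (G : RobustMarkovGame ι S A) (P : S → (∀ i, A i) → S → ℝ)
    (π : JointPolicy S A) (i : ι) (s : S) : ℝ :=
  liminf (fun n : ℕ => (1 / (n : ℝ)) * ∑ t ∈ Finset.range n, G.expectedReward P π i t s) atTop

/-- The robust `γ`-discounted value: the worst case over the uncertainty set. -/
def robustDiscountedValue (G : RobustMarkovGame ι S A) (γ : ℝ)
    (π : JointPolicy S A) (i : ι) (s : S) : ℝ :=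
  ⨅ P : G.kernels, G.discountedValue γ P π i s

/-- The robust average reward: the worst case over the uncertainty set. -/
def robustAverageReward (G : RobustMarkovGame ι S A)
    (π : JointPolicy S A) (i : ι) (s : S) : ℝ :=
  ⨅ P : G.kernels, G.averageReward P π i s

/-- `ε`-Nash equilibria of the `γ`-discounted robust game: no agent can gain more than `ε` in any
state by switching to another stationary policy. -/
def IsDiscountedEpsNash (G : RobustMarkovGame ι S A) (γ ε : ℝ) (π : JointPolicy S A) : Prop :=
  ∀ (i : ι) (μ : StationaryPolicy S (A i)) (s : S),
    G.robustDiscountedValue γ (Function.update π i μ) i s ≤ G.robustDiscountedValue γ π i s + ε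

/-- Nash equilibria of the `γ`-discounted robust game. -/
def IsDiscountedNash (G : RobustMarkovGame ι S A) (γ : ℝ) (π : JointPolicy S A) : Prop :=
  ∀ (i : ι) (μ : StationaryPolicy S (A i)) (s : S),
    G.robustDiscountedValue γ (Function.update π i μ) i s ≤ G.robustDiscountedValue γ π i s

/-- `ε`-Nash equilibria of the robust game with average reward. -/
def IsAverageEpsNash (G : RobustMarkovGame ι S A) (ε : ℝ) (π : JointPolicy S A) : Prop :=
  ∀ (i : ι) (μ : StationaryPolicy S (A i)) (s : S),
    G.robustAverageReward (Function.update π i μ) i s ≤ G.robustAverageReward π i s + ε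

/-- Nash equilibria of the robust game with average reward. -/
def IsAverageNash (G : RobustMarkovGame ι S A) (π : JointPolicy S A) : Prop :=
  ∀ (i : ι) (μ : StationaryPolicy S (A i)) (s : S),
    G.robustAverageReward (Function.update π i μ) i s ≤ G.robustAverageReward π i s

/-- Every deterministic joint policy and every kernel of the uncertainty set induce an irreducible
Markov chain, and the uncertainty set is compact and convex. -/
structure IsRegular (G : RobustMarkovGame ι S A) : Prop where
  irreducible : ∀ π : JointPolicy S A, π.IsDeterministic → ∀ P ∈ G.kernels,
    (transitionMatrix P π).IsIrreducible
  isCompact : IsCompact G.kernels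
  convex : Convex ℝ G.kernels

end RobustMarkovGame

end

noncomputable section

set_option linter.unusedSectionVars false

/-! ### Discounted sums along a stochastic matrix. -/

namespace Matrix

variable {S : Type*} [Fintype S] [DecidableEq S] {T : Matrix S S ℝ}

/-! Everything rests on one uniform estimate: a constant `K` depending only on the game with `|g -
(1 - γ) V| ≤ (1 - γ) K` for all policies, kernels and discount factors.

A discounted value `v = r + γ T v` changes by at most 1 under `T`. If all entries of `R = ∑
2^{-(t+1)} T^t` are at least `η`, this forces the span of `v` to be at most `η⁻¹`
(`sub_le_inv_of_le_geometricMean`), and a bounded span pins the average reward to `(1 - γ) v`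
(`abs_liminf_average_sub_le`). Irreducibility makes `R` positive even for periodic chains, where no
single power of `T` need be; since `R` depends continuously on `T`, compactness of the set of
policies and kernels gives a common `η` (`IsRegular.exists_le_geometricMean`).

The estimate survives the infimum over kernels. Hence the robust average reward is a uniform limit
of continuous functions of the policy, and discounted equilibrium inequalities, multiplied by `1 -
γ`, pass to average rewards up to `2 (1 - γ) K`. -/

theorem mulVec_le_of_mem_rowStochastic (hT : T ∈ rowStochastic ℝ S) {u : S → ℝ} {c : ℝ}
    (hu : ∀ s, u s ≤ c) (s : S) : (T *ᵥ u) s ≤ c :=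
  calc (T *ᵥ u) s = ∑ j, T s j * u j := rfl
    _ ≤ ∑ j, T s j * c := Finset.sum_le_sum fun j _ =>
        mul_le_mul_of_nonneg_left (hu j) (nonneg_of_mem_rowStochastic hT)
    _ = c := by rw [← Finset.sum_mul, sum_row_of_mem_rowStochastic hT, one_mul]

theorem le_mulVec_of_mem_rowStochastic (hT : T ∈ rowStochastic ℝ S) {u : S → ℝ} {c : ℝ}
    (hu : ∀ s, c ≤ u s) (s : S) : c ≤ (T *ᵥ u) s := by
  have := mulVec_le_of_mem_rowStochastic hT (u := -u) (c := -c) (fun s => neg_le_neg (hu s)) s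
  rw [mulVec_neg, Pi.neg_apply] at this
  linarith

theorem pow_mulVec_mem_Icc (hT : T ∈ rowStochastic ℝ S) {u : S → ℝ} {a b : ℝ}
    (hu : ∀ s, u s ∈ Set.Icc a b) (t : ℕ) (s : S) : ((T ^ t) *ᵥ u) s ∈ Set.Icc a b :=
  ⟨le_mulVec_of_mem_rowStochastic (pow_mem hT t) (fun s => (hu s).1) s,
    mulVec_le_of_mem_rowStochastic (pow_mem hT t) (fun s => (hu s).2) s⟩

/-- The discounted sum of the rewards `r` along the chain `T`. -/
def discountedSum (T : Matrix S S ℝ) (γ : ℝ) (r : S → ℝ) (s : S) : ℝ :=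
  ∑' t : ℕ, γ ^ t * ((T ^ t) *ᵥ r) s

theorem norm_pow_mul_mulVec_le (hT : T ∈ rowStochastic ℝ S) {γ : ℝ} (h0 : 0 ≤ γ)
    {r : S → ℝ} (hr : ∀ s, r s ∈ Set.Icc (0 : ℝ) 1) (t : ℕ) (s : S) :
    ‖γ ^ t * ((T ^ t) *ᵥ r) s‖ ≤ γ ^ t := by
  have h := pow_mulVec_mem_Icc hT hr t s
  rw [Real.norm_of_nonneg (mul_nonneg (pow_nonneg h0 t) h.1)]
  exact mul_le_of_le_one_right (pow_nonneg h0 t) h.2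

theorem summable_discountedSum (hT : T ∈ rowStochastic ℝ S) {γ : ℝ} (h0 : 0 ≤ γ) (h1 : γ < 1)
    {r : S → ℝ} (hr : ∀ s, r s ∈ Set.Icc (0 : ℝ) 1) (s : S) :
    Summable fun t : ℕ => γ ^ t * ((T ^ t) *ᵥ r) s :=
  .of_norm_bounded (summable_geometric_of_lt_one h0 h1)
    fun t => norm_pow_mul_mulVec_le hT h0 hr t s

theorem discountedSum_nonneg (hT : T ∈ rowStochastic ℝ S) {γ : ℝ} (h0 : 0 ≤ γ)
    {r : S → ℝ} (hr : ∀ s, r s ∈ Set.Icc (0 : ℝ) 1) (s : S) : 0 ≤ discountedSum T γ r s :=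
  tsum_nonneg fun t => mul_nonneg (pow_nonneg h0 t) (pow_mulVec_mem_Icc hT hr t s).1

theorem discountedSum_le (hT : T ∈ rowStochastic ℝ S) {γ : ℝ} (h0 : 0 ≤ γ) (h1 : γ < 1)
    {r : S → ℝ} (hr : ∀ s, r s ∈ Set.Icc (0 : ℝ) 1) (s : S) :
    discountedSum T γ r s ≤ (1 - γ)⁻¹ := by
  rw [← tsum_geometric_of_lt_one h0 h1]
  exact (summable_discountedSum hT h0 h1 hr s).tsum_le_tsum
    (fun t => (le_abs_self _).trans (norm_pow_mul_mulVec_le hT h0 hr t s))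
    (summable_geometric_of_lt_one h0 h1)

theorem discountedSum_eq (hT : T ∈ rowStochastic ℝ S) {γ : ℝ} (h0 : 0 ≤ γ) (h1 : γ < 1)
    {r : S → ℝ} (hr : ∀ s, r s ∈ Set.Icc (0 : ℝ) 1) :
    discountedSum T γ r = r + γ • (T *ᵥ discountedSum T γ r) := by
  ext s
  have hs := summable_discountedSum hT h0 h1 hr
  rw [discountedSum, (hs s).tsum_eq_zero_add]
  simp only [pow_zero, one_mulVec, one_mul, Pi.add_apply, Pi.smul_apply, smul_eq_mul]
  congr 1
  have : (T *ᵥ discountedSum T γ r) s = ∑' t : ℕ, ∑ j, T s j * (γ ^ t * ((T ^ t) *ᵥ r) j) := by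
    rw [Summable.tsum_finsetSum fun j _ => (hs j).mul_left _]
    simp only [tsum_mul_left]
    rfl
  rw [this, ← tsum_mul_left]
  refine tsum_congr fun t => ?_
  rw [pow_succ' T, ← mulVec_mulVec, pow_succ]
  simp only [mulVec, dotProduct, Finset.mul_sum]
  refine Finset.sum_congr rfl fun j _ => Finset.sum_congr rfl fun k _ => ?_
  ring

/-- By the Bellman equation `v - T v = r - (1 - γ) T v`, a difference of two numbers in `[0, 1]`.
The bound does not degrade as `γ → 1`, although `v` itself may grow like `(1 - γ)⁻¹`. -/
theorem abs_sub_mulVec_discountedSum_le (hT : T ∈ rowStochastic ℝ S) {γ : ℝ} (h0 : 0 ≤ γ)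
    (h1 : γ < 1) {r : S → ℝ} (hr : ∀ s, r s ∈ Set.Icc (0 : ℝ) 1) (s : S) :
    |discountedSum T γ r s - (T *ᵥ discountedSum T γ r) s| ≤ 1 := by
  have hb := congrFun (discountedSum_eq hT h0 h1 hr) s
  simp only [Pi.add_apply, Pi.smul_apply, smul_eq_mul] at hb
  have hl := le_mulVec_of_mem_rowStochastic hT (discountedSum_nonneg hT h0 hr) s
  have hu := mulVec_le_of_mem_rowStochastic hT (discountedSum_le hT h0 h1 hr) s
  have hm : (1 - γ) * (T *ᵥ discountedSum T γ r) s ≤ 1 := by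
    calc _ ≤ (1 - γ) * (1 - γ)⁻¹ := mul_le_mul_of_nonneg_left hu (by linarith)
      _ = 1 := mul_inv_cancel₀ (by linarith)
  have hm0 : 0 ≤ (1 - γ) * (T *ᵥ discountedSum T γ r) s := mul_nonneg (by linarith) hl
  have := hr s
  rw [abs_le]
  constructor <;> linarith [this.1, this.2]

/-- Telescoping: each increment `T ^ t (v - T v)` stays in `[-1, 1]`. -/
theorem abs_sub_pow_mulVec_le (hT : T ∈ rowStochastic ℝ S) {v : S → ℝ}
    (hv : ∀ s, |v s - (T *ᵥ v) s| ≤ 1) (t : ℕ) (s : S) : |v s - ((T ^ t) *ᵥ v) s| ≤ t := by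
  induction t with
  | zero => simp
  | succ t ih =>
    have h := pow_mulVec_mem_Icc hT (u := v - T *ᵥ v) (fun s => abs_le.1 (hv s)) t s
    rw [mulVec_sub, mulVec_mulVec, ← pow_succ, Pi.sub_apply] at h
    rw [abs_le] at ih ⊢
    push_cast
    constructor <;> linarith [h.1, h.2]

/-! ### Geometric mean of the powers and span bound. -/

/-- The average of the powers of `T` with the weights `2⁻¹, 2⁻², 2⁻³, …`. -/
def geometricMean (T : Matrix S S ℝ) : Matrix S S ℝ :=
  of fun s s' => ∑' t : ℕ, (1 / 2 : ℝ) ^ (t + 1) * (T ^ t) s s'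

theorem summable_half_pow_succ : Summable fun t : ℕ => (1 / 2 : ℝ) ^ (t + 1) :=
  (summable_nat_add_iff 1).2 summable_geometric_two

theorem tsum_half_pow_succ : ∑' t : ℕ, (1 / 2 : ℝ) ^ (t + 1) = 1 := by
  simp only [pow_succ, tsum_mul_right, tsum_geometric_two]
  norm_num

theorem norm_half_pow_mul_le (hT : T ∈ rowStochastic ℝ S) (t : ℕ) (s s' : S) :
    ‖(1 / 2 : ℝ) ^ (t + 1) * (T ^ t) s s'‖ ≤ (1 / 2 : ℝ) ^ (t + 1) := by
  rw [Real.norm_of_nonneg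
    (mul_nonneg (by positivity) (nonneg_of_mem_rowStochastic (pow_mem hT t)))]
  exact mul_le_of_le_one_right (by positivity) (le_one_of_mem_rowStochastic (pow_mem hT t))

theorem summable_geometricMean (hT : T ∈ rowStochastic ℝ S) (s s' : S) :
    Summable fun t : ℕ => (1 / 2 : ℝ) ^ (t + 1) * (T ^ t) s s' :=
  .of_norm_bounded summable_half_pow_succ fun t => norm_half_pow_mul_le hT t s s'

theorem hasSum_geometricMean_mulVec (hT : T ∈ rowStochastic ℝ S) (v : S → ℝ) (s : S) :
    HasSum (fun t : ℕ => (1 / 2 : ℝ) ^ (t + 1) * ((T ^ t) *ᵥ v) s) ((geometricMean T *ᵥ v) s) := by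
  have := hasSum_sum fun (j : S) (_ : j ∈ Finset.univ) =>
    (summable_geometricMean hT s j).hasSum.mul_right (v j)
  have e (t : ℕ) : (1 / 2 : ℝ) ^ (t + 1) * ((T ^ t) *ᵥ v) s
      = ∑ j, (1 / 2 : ℝ) ^ (t + 1) * (T ^ t) s j * v j := by
    simp only [mulVec, dotProduct, Finset.mul_sum, mul_assoc]
  simp only [e]
  exact this

theorem geometricMean_mem_rowStochastic (hT : T ∈ rowStochastic ℝ S) :
    geometricMean T ∈ rowStochastic ℝ S := by
  refine ⟨fun s s' => tsum_nonneg fun t => mul_nonneg (by positivity)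
    (nonneg_of_mem_rowStochastic (pow_mem hT t)), ?_⟩
  ext s
  rw [← (hasSum_geometricMean_mulVec hT 1 s).tsum_eq]
  have h (t : ℕ) : (T ^ t) *ᵥ (1 : S → ℝ) = 1 := one_vecMul_of_mem_rowStochastic (pow_mem hT t)
  simp only [h, Pi.one_apply, mul_one]
  exact tsum_half_pow_succ

theorem abs_sub_geometricMean_mulVec_le (hT : T ∈ rowStochastic ℝ S) {v : S → ℝ}
    (hv : ∀ s, |v s - (T *ᵥ v) s| ≤ 1) (s : S) : |v s - (geometricMean T *ᵥ v) s| ≤ 1 := by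
  have h1 : HasSum (fun t : ℕ => (1 / 2 : ℝ) ^ (t + 1) * v s) (v s) := by
    have := (summable_half_pow_succ.hasSum).mul_right (v s)
    rwa [tsum_half_pow_succ, one_mul] at this
  -- The mean of `t` under the weights is exactly 1, so the bounds `t` average to 1.
  have h2 : HasSum (fun t : ℕ => (1 / 2 : ℝ) ^ (t + 1) * t) 1 := by
    have := (hasSum_coe_mul_geometric_of_norm_lt_one (r := (1 / 2 : ℝ))
      (by norm_num)).mul_left (1 / 2)
    have e : (1 / 2 : ℝ) * (1 / 2 / (1 - 1 / 2) ^ 2) = 1 := by norm_num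
    rw [e] at this
    have e' (t : ℕ) : (1 / 2 : ℝ) ^ (t + 1) * t = 1 / 2 * (t * (1 / 2) ^ t) := by ring
    simpa only [e'] using this
  have h3 := h1.sub (hasSum_geometricMean_mulVec hT v s)
  have hb (t : ℕ) := abs_le.1 (abs_sub_pow_mulVec_le hT hv t s)
  have hp (t : ℕ) : (0 : ℝ) ≤ (1 / 2) ^ (t + 1) := by positivity
  rw [abs_le]
  refine ⟨hasSum_le (fun t => ?_) h2.neg h3, hasSum_le (fun t => ?_) h3 h2⟩ <;>
    nlinarith [hp t, hb t, mul_le_mul_of_nonneg_left (hb t).1 (hp t),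
      mul_le_mul_of_nonneg_left (hb t).2 (hp t)]

/-- If all entries of the geometric mean are at least `η`, then values that one step of the chain
changes by at most one differ by at most `η⁻¹`. -/
theorem sub_le_inv_of_le_geometricMean (hT : T ∈ rowStochastic ℝ S) {v : S → ℝ}
    (hv : ∀ s, |v s - (T *ᵥ v) s| ≤ 1) {η : ℝ} (hη : 0 < η)
    (hR : ∀ s s', η ≤ geometricMean T s s') (s s' : S) : v s' - v s ≤ η⁻¹ := by
  -- At a minimizer of `v` every term of `(R v - v) s₀` is nonnegative, so each single term is at
  -- most 1.
  obtain ⟨s₀, -, hs₀⟩ := Finset.exists_min_image Finset.univ v ⟨s, Finset.mem_univ s⟩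
  have hmem := geometricMean_mem_rowStochastic hT
  have h1 := (abs_le.1 (abs_sub_geometricMean_mulVec_le hT hv s₀)).1
  have h2 : (geometricMean T *ᵥ v) s₀ - v s₀ = ∑ j, geometricMean T s₀ j * (v j - v s₀) := by
    simp only [mul_sub, Finset.sum_sub_distrib, ← Finset.sum_mul,
      sum_row_of_mem_rowStochastic hmem, one_mul]
    rfl
  have h3 : geometricMean T s₀ s' * (v s' - v s₀)
      ≤ ∑ j, geometricMean T s₀ j * (v j - v s₀) :=
    Finset.single_le_sum (f := fun j => geometricMean T s₀ j * (v j - v s₀))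
      (fun j _ => mul_nonneg (nonneg_of_mem_rowStochastic hmem)
        (sub_nonneg.2 (hs₀ j (Finset.mem_univ j)))) (Finset.mem_univ s')
  have h4 : η * (v s' - v s₀) ≤ geometricMean T s₀ s' * (v s' - v s₀) :=
    mul_le_mul_of_nonneg_right (hR s₀ s') (sub_nonneg.2 (hs₀ s' (Finset.mem_univ s')))
  have h5 : v s' - v s₀ ≤ η⁻¹ := by
    rw [← mul_le_mul_iff_of_pos_left hη, mul_inv_cancel₀ hη.ne']
    linarith
  linarith [hs₀ s (Finset.mem_univ s)]

theorem geometricMean_pos (hT : T ∈ rowStochastic ℝ S) (hirr : ∀ s s', ∃ t, 0 < (T ^ t) s s')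
    (s s' : S) : 0 < geometricMean T s s' := by
  obtain ⟨t, ht⟩ := hirr s s'
  exact (summable_geometricMean hT s s').tsum_pos
    (fun n => mul_nonneg (by positivity) (nonneg_of_mem_rowStochastic (pow_mem hT n))) t
    (by positivity)

theorem continuous_geometricMean {X : Type*} [TopologicalSpace X] {M : X → Matrix S S ℝ}
    (hM : Continuous M) (hst : ∀ x, M x ∈ rowStochastic ℝ S) (s s' : S) :
    Continuous fun x => geometricMean (M x) s s' :=
  continuous_tsum (fun t => continuous_const.mul ((hM.pow t).matrix_elem s s'))
    summable_half_pow_succ fun t x => norm_half_pow_mul_le (hst x) t s s'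

theorem continuous_discountedSum {X : Type*} [TopologicalSpace X] {M : X → Matrix S S ℝ}
    (hM : Continuous M) (hst : ∀ x, M x ∈ rowStochastic ℝ S) {γ : ℝ} (h0 : 0 ≤ γ) (h1 : γ < 1)
    {r : X → S → ℝ} (hrc : Continuous r) (hr : ∀ x s, r x s ∈ Set.Icc (0 : ℝ) 1) (s : S) :
    Continuous fun x => discountedSum (M x) γ (r x) s :=
  continuous_tsum
    (fun t => continuous_const.mul ((continuous_apply s).comp ((hM.pow t).matrix_mulVec hrc)))
    (summable_geometric_of_lt_one h0 h1)
    fun t x => norm_pow_mul_mulVec_le (hst x) h0 (hr x) t s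

/-! ### Average reward against the normalized discounted sum. -/

/-- Substituting `r = v - γ T v` and splitting `γ = 1 - (1 - γ)` leaves a telescoping sum and a
multiple of `1 - γ`. -/
theorem sum_pow_mulVec_eq {γ : ℝ} {r v : S → ℝ} (hv : v = r + γ • (T *ᵥ v)) (n : ℕ) (s : S) :
    ∑ t ∈ Finset.range n, ((T ^ t) *ᵥ r) s = v s - ((T ^ n) *ᵥ v) s
      + (1 - γ) * ∑ t ∈ Finset.range n, ((T ^ (t + 1)) *ᵥ v) s := by
  have hr : r = v - γ • (T *ᵥ v) := eq_sub_of_add_eq hv.symm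
  induction n with
  | zero => simp
  | succ n ih =>
    have h : ((T ^ n) *ᵥ r) s = ((T ^ n) *ᵥ v) s - γ * ((T ^ (n + 1)) *ᵥ v) s := by
      rw [hr, mulVec_sub, mulVec_smul, mulVec_mulVec, ← pow_succ]
      rfl
    rw [Finset.sum_range_succ, Finset.sum_range_succ, ih, h]
    ring

theorem abs_sum_pow_mulVec_sub_le (hT : T ∈ rowStochastic ℝ S) {γ : ℝ} (h1 : γ ≤ 1)
    {r v : S → ℝ} (hv : v = r + γ • (T *ᵥ v)) {K : ℝ} (hK : ∀ s s', v s' - v s ≤ K)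
    (n : ℕ) (s : S) :
    |∑ t ∈ Finset.range n, ((T ^ t) *ᵥ r) s - n * ((1 - γ) * v s)| ≤ K + n * ((1 - γ) * K) := by
  have hmem (t : ℕ) : ((T ^ t) *ᵥ v) s ∈ Set.Icc (v s - K) (v s + K) :=
    pow_mulVec_mem_Icc hT
      (fun s' => ⟨by linarith [hK s' s], by linarith [hK s s']⟩) t s
  have hl : n * (v s - K) ≤ ∑ t ∈ Finset.range n, ((T ^ (t + 1)) *ᵥ v) s := by
    simpa using Finset.card_nsmul_le_sum (Finset.range n) _ _ fun t _ => (hmem (t + 1)).1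
  have hu : ∑ t ∈ Finset.range n, ((T ^ (t + 1)) *ᵥ v) s ≤ n * (v s + K) := by
    simpa [mul_add] using Finset.sum_le_card_nsmul (Finset.range n) _ _ fun t _ => (hmem (t + 1)).2
  have hl' := mul_le_mul_of_nonneg_left hl (sub_nonneg.2 h1)
  have hu' := mul_le_mul_of_nonneg_left hu (sub_nonneg.2 h1)
  have hn := hmem n
  rw [sum_pow_mulVec_eq hv, abs_le]
  constructor <;> nlinarith [hn.1, hn.2]

/-- With `γ` fixed, the telescoped boundary term contributes only `K / n`. -/
theorem abs_liminf_average_sub_le (hT : T ∈ rowStochastic ℝ S) {γ : ℝ} (h1 : γ ≤ 1)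
    {r v : S → ℝ} (hv : v = r + γ • (T *ᵥ v)) {K : ℝ} (hK : ∀ s s', v s' - v s ≤ K) (s : S) :
    |liminf (fun n : ℕ => (1 / (n : ℝ)) * ∑ t ∈ Finset.range n, ((T ^ t) *ᵥ r) s) atTop
      - (1 - γ) * v s| ≤ (1 - γ) * K := by
  set c := (1 - γ) * v s
  set d := (1 - γ) * K
  set f := fun n : ℕ => (1 / (n : ℝ)) * ∑ t ∈ Finset.range n, ((T ^ t) *ᵥ r) s
  have hlim : Tendsto (fun n : ℕ => K * (1 / (n : ℝ))) atTop (𝓝 0) := by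
    simpa using tendsto_one_div_atTop_nhds_zero_nat.const_mul K
  have hlo : Tendsto (fun n : ℕ => c - d - K * (1 / (n : ℝ))) atTop (𝓝 (c - d)) := by
    simpa using hlim.const_sub (c - d)
  have hup : Tendsto (fun n : ℕ => c + d + K * (1 / (n : ℝ))) atTop (𝓝 (c + d)) := by
    simpa using hlim.const_add (c + d)
  have key : ∀ᶠ n : ℕ in atTop, c - d - K * (1 / (n : ℝ)) ≤ f n ∧
      f n ≤ c + d + K * (1 / (n : ℝ)) := by
    filter_upwards [eventually_gt_atTop 0] with n hn
    have hn' : (0 : ℝ) < n := by exact_mod_cast hn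
    have h := abs_le.1 (abs_sum_pow_mulVec_sub_le hT h1 hv hK n s)
    have hi : (0 : ℝ) ≤ 1 / n := by positivity
    have e (x : ℝ) : 1 / (n : ℝ) * (n * x) = x := by field_simp
    have hl := mul_le_mul_of_nonneg_left h.1 hi
    have hu := mul_le_mul_of_nonneg_left h.2 hi
    rw [mul_sub, e] at hl hu
    rw [mul_neg, mul_add, e] at hl
    rw [mul_add, e] at hu
    constructor <;> linarith
  have hfl : IsBoundedUnder (· ≥ ·) atTop f :=
    hlo.isBoundedUnder_ge.mono_ge (key.mono fun n h => h.1)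
  have hfu : IsBoundedUnder (· ≤ ·) atTop f :=
    hup.isBoundedUnder_le.mono_le (key.mono fun n h => h.2)
  have h2 := liminf_le_liminf (key.mono fun n h => h.1) hlo.isBoundedUnder_ge
    hfu.isCoboundedUnder_ge
  have h3 := liminf_le_liminf (key.mono fun n h => h.2) hfl
    hup.isBoundedUnder_le.isCoboundedUnder_ge
  rw [hlo.liminf_eq] at h2
  rw [hup.liminf_eq] at h3
  rw [abs_le]
  constructor <;> linarith

/-- Entrywise domination passes to powers; nonnegativity is carried along because the induction
multiplies inequalities. -/
theorem pow_mul_pow_apply_le {D : Matrix S S ℝ} {c : ℝ} (hc : 0 ≤ c) (hD : ∀ s s', 0 ≤ D s s')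
    (h : ∀ s s', c * D s s' ≤ T s s') (t : ℕ) (s s' : S) :
    0 ≤ (D ^ t) s s' ∧ c ^ t * (D ^ t) s s' ≤ (T ^ t) s s' := by
  induction t generalizing s s' with
  | zero => simp only [pow_zero, one_mul, le_refl, and_true, one_apply]; split_ifs <;> norm_num
  | succ t ih =>
    simp only [pow_succ, mul_apply, Finset.mul_sum]
    refine ⟨Finset.sum_nonneg fun j _ => mul_nonneg (ih s j).1 (hD j s'),
      Finset.sum_le_sum fun j _ => ?_⟩
    calc c ^ t * c * ((D ^ t) s j * D j s') = (c ^ t * (D ^ t) s j) * (c * D j s') := by ring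
      _ ≤ (T ^ t) s j * T j s' := mul_le_mul (ih s j).2 (h j s') (mul_nonneg hc (hD j s'))
          ((mul_nonneg (pow_nonneg hc t) (ih s j).1).trans (ih s j).2)

end Matrix

/-! ### Product policies. -/

namespace JointPolicy

variable {ι S : Type*} {A : ι → Type*} [Fintype ι] [∀ i, Fintype (A i)]

theorem prob_nonneg (π : JointPolicy S A) (s : S) (a : ∀ i, A i) : 0 ≤ π.prob s a :=
  Finset.prod_nonneg fun i _ => (π i s).2.1 (a i)

theorem sum_prob [DecidableEq ι] (π : JointPolicy S A) (s : S) : ∑ a, π.prob s a = 1 := by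
  simp only [prob]
  rw [← Fintype.piFinset_univ, ← Finset.prod_univ_sum]
  exact Finset.prod_eq_one fun i _ => (π i s).2.2

theorem continuous_prob (s : S) (a : ∀ i, A i) :
    Continuous fun π : JointPolicy S A => π.prob s a :=
  continuous_finsetProd _ fun i _ => (continuous_apply (a i)).comp
    (continuous_subtype_val.comp ((continuous_apply s).comp (continuous_apply i)))

/-- The joint policy in which agent `i` plays the action `d s i` in state `s`. -/
def ofActions [∀ i, DecidableEq (A i)] (d : S → ∀ i, A i) : JointPolicy S A :=
  fun i s => ⟨Pi.single (d s i) 1, single_mem_stdSimplex ℝ (d s i)⟩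

theorem isDeterministic_ofActions [∀ i, DecidableEq (A i)] (d : S → ∀ i, A i) :
    (ofActions d).IsDeterministic := fun i s => ⟨d s i, Pi.single_eq_same _ _⟩

theorem prob_ofActions [∀ i, DecidableEq (A i)] (d : S → ∀ i, A i) (s : S) (a : ∀ i, A i) :
    (ofActions d).prob s a = if a = d s then 1 else 0 := by
  split_ifs with h
  · subst h
    exact Finset.prod_eq_one fun i _ => Pi.single_eq_same _ _
  · obtain ⟨i, hi⟩ := Function.ne_iff.1 h
    exact Finset.prod_eq_zero (Finset.mem_univ i) (Pi.single_eq_of_ne hi _)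

theorem exists_prob_pos [DecidableEq ι] (π : JointPolicy S A) (s : S) :
    ∃ a, 0 < π.prob s a := by
  by_contra! h
  have := Finset.sum_nonpos fun a (_ : a ∈ Finset.univ) => h a
  rw [sum_prob] at this
  linarith

end JointPolicy

/-! ### Uniform estimates for the game. -/

namespace RobustMarkovGame

open Matrix

variable {ι S : Type*} {A : ι → Type*}
  [Fintype ι] [DecidableEq ι] [Fintype S] [DecidableEq S] [∀ i, Fintype (A i)]
  {G : RobustMarkovGame ι S A} {P : S → (∀ i, A i) → S → ℝ}

theorem transitionMatrix_mem_rowStochastic (hP : P ∈ G.kernels) (π : JointPolicy S A) :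
    transitionMatrix P π ∈ rowStochastic ℝ S := by
  have h (s a) : P s a ∈ stdSimplex ℝ S := G.uncertainty_subset s a (hP s a)
  refine mem_rowStochastic_iff_sum.2 ⟨fun s s' => Finset.sum_nonneg fun a _ =>
    mul_nonneg (π.prob_nonneg s a) ((h s a).1 s'), fun s => ?_⟩
  simp only [transitionMatrix, of_apply]
  rw [Finset.sum_comm]
  simp only [← Finset.mul_sum, (h s _).2, mul_one]
  exact π.sum_prob s

theorem transitionMatrix_ofActions [∀ i, DecidableEq (A i)] (P : S → (∀ i, A i) → S → ℝ)
    (d : S → ∀ i, A i) (s s' : S) :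
    transitionMatrix P (JointPolicy.ofActions d) s s' = P s (d s) s' := by
  simp [transitionMatrix, JointPolicy.prob_ofActions]

theorem continuous_transitionMatrix (G : RobustMarkovGame ι S A) :
    Continuous fun x : JointPolicy S A × G.kernels => transitionMatrix x.2.1 x.1 := by
  refine continuous_matrix fun s s' => continuous_finsetSum _ fun a _ => ?_
  have hP : Continuous fun x : JointPolicy S A × G.kernels => x.2.1 s a s' :=
    (continuous_apply s').comp ((continuous_apply a).comp ((continuous_apply s).comp
      (continuous_subtype_val.comp continuous_snd)))
  exact ((JointPolicy.continuous_prob s a).comp continuous_fst).mul hP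

theorem policyReward_mem_Icc (π : JointPolicy S A) (i : ι) (s : S) :
    G.policyReward π i s ∈ Set.Icc (0 : ℝ) 1 := by
  refine ⟨Finset.sum_nonneg fun a _ => mul_nonneg (π.prob_nonneg s a) (G.reward_mem i s a).1, ?_⟩
  rw [← π.sum_prob s]
  exact Finset.sum_le_sum fun a _ =>
    mul_le_of_le_one_right (π.prob_nonneg s a) (G.reward_mem i s a).2

theorem continuous_policyReward (G : RobustMarkovGame ι S A) (i : ι) :
    Continuous fun π : JointPolicy S A => G.policyReward π i :=
  continuous_pi fun s => continuous_finsetSum _ fun a _ =>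
    (JointPolicy.continuous_prob s a).mul continuous_const

/-- If all deterministic policies induce irreducible chains, then so do all policies. -/
theorem IsRegular.exists_pow_pos (hG : G.IsRegular) (hP : P ∈ G.kernels) (π : JointPolicy S A)
    (s s' : S) : ∃ t, 0 < (transitionMatrix P π ^ t) s s' := by
  classical
  -- Playing a joint action of positive probability in each state gives a deterministic policy; its
  -- matrix, scaled by the least of these probabilities, is dominated by that of `π`.
  choose d hd using π.exists_prob_pos
  have hD := hG.irreducible _ (JointPolicy.isDeterministic_ofActions d) P hP
  obtain ⟨t, -, ht⟩ := (isIrreducible_iff_exists_pow_pos hD.nonneg).1 hD s s'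
  obtain ⟨s₀, -, hs₀⟩ := Finset.exists_min_image Finset.univ (fun s => π.prob s (d s))
    ⟨s, Finset.mem_univ s⟩
  have h (x y) : π.prob s₀ (d s₀) * transitionMatrix P (JointPolicy.ofActions d) x y
      ≤ transitionMatrix P π x y := by
    have hn (a) : 0 ≤ P x a y := (G.uncertainty_subset x a (hP x a)).1 y
    rw [transitionMatrix_ofActions]
    exact (mul_le_mul_of_nonneg_right (hs₀ x (Finset.mem_univ x)) (hn _)).trans
      (Finset.single_le_sum (f := fun a => π.prob x a * P x a y)
        (fun a _ => mul_nonneg (π.prob_nonneg x a) (hn a)) (Finset.mem_univ (d x)))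
  exact ⟨t, (mul_pos (pow_pos (hd s₀) t) ht).trans_le
    (pow_mul_pow_apply_le (hd s₀).le hD.nonneg h t s s').2⟩

theorem IsRegular.exists_le_geometricMean (hG : G.IsRegular) :
    ∃ η : ℝ, 0 < η ∧ ∀ P ∈ G.kernels, ∀ (π : JointPolicy S A) (s s' : S),
      η ≤ geometricMean (transitionMatrix P π) s s' := by
  have : CompactSpace G.kernels := isCompact_iff_compactSpace.1 hG.isCompact
  have hst (x : JointPolicy S A × G.kernels) : transitionMatrix x.2.1 x.1 ∈ rowStochastic ℝ S :=
    transitionMatrix_mem_rowStochastic x.2.2 x.1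
  have hc := continuous_geometricMean G.continuous_transitionMatrix hst
  -- Stated for all small `η > 0`, so that the finitely many pairs of states combine at once, also
  -- when there are none.
  have hev (s s' : S) : ∀ᶠ η : ℝ in 𝓝[>] 0,
      ∀ x : JointPolicy S A × G.kernels, η ≤ geometricMean (transitionMatrix x.2.1 x.1) s s' := by
    rcases isEmpty_or_nonempty (JointPolicy S A × G.kernels) with hX | hX
    · exact .of_forall fun η x => isEmptyElim x
    · obtain ⟨x₀, -, hx₀⟩ := isCompact_univ.exists_isMinOn Set.univ_nonempty (hc s s').continuousOn
      have h0 : 0 < geometricMean (transitionMatrix x₀.2.1 x₀.1) s s' :=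
        geometricMean_pos (hst x₀) (hG.exists_pow_pos x₀.2.2 x₀.1) s s'
      filter_upwards [nhdsWithin_le_nhds (Iio_mem_nhds h0)] with η hη x
      exact (le_of_lt hη).trans (hx₀ (Set.mem_univ x))
  obtain ⟨η, h1, h2⟩ := ((eventually_all.2 fun s => eventually_all.2 fun s' => hev s s').and
    self_mem_nhdsWithin).exists
  exact ⟨η, h2, fun P hP π s s' => h1 s s' (π, ⟨P, hP⟩)⟩

/-- The average reward is the limit of the normalized discounted values, uniformly over all
policies and kernels. -/
theorem IsRegular.exists_abs_averageReward_sub_le (hG : G.IsRegular) :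
    ∃ K : ℝ, 0 < K ∧ ∀ γ : ℝ, 0 ≤ γ → γ < 1 → ∀ P ∈ G.kernels,
      ∀ (π : JointPolicy S A) (i : ι) (s : S),
        |G.averageReward P π i s - (1 - γ) * G.discountedValue γ P π i s| ≤ (1 - γ) * K := by
  obtain ⟨η, hη, h⟩ := hG.exists_le_geometricMean
  refine ⟨η⁻¹, inv_pos.2 hη, fun γ h0 h1 P hP π i s => ?_⟩
  have hT := transitionMatrix_mem_rowStochastic hP π
  have hr := policyReward_mem_Icc (G := G) π i
  exact abs_liminf_average_sub_le hT h1.le (discountedSum_eq hT h0 h1 hr)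
    (sub_le_inv_of_le_geometricMean hT (abs_sub_mulVec_discountedSum_le hT h0 h1 hr) hη (h P hP π))
    s

theorem nonempty_kernels (G : RobustMarkovGame ι S A) : Nonempty G.kernels := by
  choose P hP using G.uncertainty_nonempty
  exact ⟨⟨P, hP⟩⟩

theorem abs_ciInf_sub_ciInf_le {X : Type*} [Nonempty X] {f g : X → ℝ} {c : ℝ}
    (hg : BddBelow (Set.range g)) (h : ∀ x, |f x - g x| ≤ c) : |(⨅ x, f x) - ⨅ x, g x| ≤ c := by
  have hf : BddBelow (Set.range f) := by
    obtain ⟨b, hb⟩ := hg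
    refine ⟨b - c, ?_⟩
    rintro _ ⟨x, rfl⟩
    linarith [hb ⟨x, rfl⟩, (abs_le.1 (h x)).1]
  have h1 : (⨅ x, g x) - c ≤ ⨅ x, f x :=
    le_ciInf fun x => by linarith [ciInf_le hg x, (abs_le.1 (h x)).1]
  have h2 : (⨅ x, f x) - c ≤ ⨅ x, g x :=
    le_ciInf fun x => by linarith [ciInf_le hf x, (abs_le.1 (h x)).2]
  rw [abs_le]
  constructor <;> linarith

/-- Infima of uniformly close functions are equally close, and the factor `1 - γ ≥ 0` moves inside
the infimum. -/
theorem IsRegular.exists_abs_robustAverageReward_sub_le (hG : G.IsRegular) :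
    ∃ K : ℝ, 0 < K ∧ ∀ γ : ℝ, 0 ≤ γ → γ < 1 → ∀ (π : JointPolicy S A) (i : ι) (s : S),
      |G.robustAverageReward π i s - (1 - γ) * G.robustDiscountedValue γ π i s|
        ≤ (1 - γ) * K := by
  obtain ⟨K, hK, h⟩ := hG.exists_abs_averageReward_sub_le
  refine ⟨K, hK, fun γ h0 h1 π i s => ?_⟩
  have := G.nonempty_kernels
  have hγ : 0 ≤ 1 - γ := sub_nonneg.2 h1.le
  rw [robustDiscountedValue, Real.mul_iInf_of_nonneg hγ]
  refine abs_ciInf_sub_ciInf_le ⟨0, ?_⟩ fun P => h γ h0 h1 P P.2 π i s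
  rintro _ ⟨P, rfl⟩
  exact mul_nonneg hγ (discountedSum_nonneg (transitionMatrix_mem_rowStochastic P.2 π) h0
    (policyReward_mem_Icc π i) s)

theorem IsRegular.continuous_robustDiscountedValue (hG : G.IsRegular) {γ : ℝ} (h0 : 0 ≤ γ)
    (h1 : γ < 1) (i : ι) (s : S) :
    Continuous fun π : JointPolicy S A => G.robustDiscountedValue γ π i s := by
  have : CompactSpace G.kernels := isCompact_iff_compactSpace.1 hG.isCompact
  have hc : Continuous fun x : JointPolicy S A × G.kernels => G.discountedValue γ x.2 x.1 i s :=
    continuous_discountedSum G.continuous_transitionMatrix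
      (fun x => transitionMatrix_mem_rowStochastic x.2.2 x.1) h0 h1
      ((G.continuous_policyReward i).comp continuous_fst) (fun x => policyReward_mem_Icc x.1 i) s
  have := IsCompact.continuous_sInf
    (f := fun (π : JointPolicy S A) (P : G.kernels) => G.discountedValue γ P π i s)
    isCompact_univ hc
  simp only [Set.image_univ] at this
  exact this

theorem IsRegular.continuous_robustAverageReward (hG : G.IsRegular) (i : ι) (s : S) :
    Continuous fun π : JointPolicy S A => G.robustAverageReward π i s := by
  obtain ⟨K, hK, h⟩ := hG.exists_abs_robustAverageReward_sub_le
  have hu : TendstoUniformly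
      (fun (γ : ℝ) (π : JointPolicy S A) => (1 - γ) * G.robustDiscountedValue γ π i s)
      (fun π => G.robustAverageReward π i s) (𝓝[<] 1) := by
    rw [Metric.tendstoUniformly_iff]
    intro ε hε
    have hlim : Tendsto (fun γ : ℝ => (1 - γ) * K) (𝓝[<] 1) (𝓝 0) := by
      have : Continuous fun γ : ℝ => (1 - γ) * K := by fun_prop
      simpa using (this.tendsto 1).mono_left nhdsWithin_le_nhds
    filter_upwards [hlim.eventually_lt_const hε, self_mem_nhdsWithin,
      nhdsWithin_le_nhds (Ici_mem_nhds (zero_lt_one (α := ℝ)))] with γ hγ h1 h0 π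
    exact (h γ h0 h1 π i s).trans_lt hγ
  refine hu.continuous (Eventually.frequently ?_)
  filter_upwards [self_mem_nhdsWithin,
    nhdsWithin_le_nhds (Ici_mem_nhds (zero_lt_one (α := ℝ)))] with γ h1 h0
  exact continuous_const.mul (hG.continuous_robustDiscountedValue h0 h1 i s)

/-! ### The two claims. -/

/-- Each `π' t` is an average-reward equilibrium up to `2 (1 - γ t) K`; continuity of both sides in
the policy allows the limit. -/
theorem IsRegular.isAverageNash_of_tendsto (hG : G.IsRegular) {γ : ℕ → ℝ}
    {π' : ℕ → JointPolicy S A} {π : JointPolicy S A} (hγ : ∀ t, 0 ≤ γ t ∧ γ t < 1)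
    (hlim : Tendsto γ atTop (𝓝 1)) (hN : ∀ t, G.IsDiscountedNash (γ t) (π' t))
    (hπ : Tendsto π' atTop (𝓝 π)) : G.IsAverageNash π := by
  obtain ⟨K, hK, h⟩ := hG.exists_abs_robustAverageReward_sub_le
  intro i μ s
  have hc := hG.continuous_robustAverageReward i s
  have hu : Continuous fun ρ : JointPolicy S A => Function.update ρ i μ :=
    continuous_id.update i continuous_const
  have hl := ((hc.comp hu).tendsto π).comp hπ
  have hd : Tendsto (fun t => 2 * ((1 - γ t) * K)) atTop (𝓝 0) := by
    simpa using ((hlim.const_sub 1).mul_const K).const_mul 2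
  have hr := ((hc.tendsto π).comp hπ).add hd
  rw [add_zero] at hr
  refine le_of_tendsto_of_tendsto' hl hr fun t => ?_
  have h1 := (abs_le.1 (h (γ t) (hγ t).1 (hγ t).2 (Function.update (π' t) i μ) i s)).2
  have h2 := (abs_le.1 (h (γ t) (hγ t).1 (hγ t).2 (π' t) i s)).1
  have h3 := mul_le_mul_of_nonneg_left (hN t i μ s) (sub_nonneg.2 (hγ t).2.le)
  simp only [Function.comp_apply]
  linarith

theorem IsRegular.exists_isAverageEpsNash (hG : G.IsRegular) {ε : ℝ} (hε : 0 < ε) :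
    ∃ γ : ℝ, 0 ≤ γ ∧ γ < 1 ∧
      ∀ π : JointPolicy S A, G.IsDiscountedEpsNash γ ε π → G.IsAverageEpsNash (3 * ε) π := by
  obtain ⟨K, hK, h⟩ := hG.exists_abs_robustAverageReward_sub_le
  have hd : 0 < min 1 (ε / K) := lt_min one_pos (div_pos hε hK)
  have h0 : 0 ≤ 1 - min 1 (ε / K) := sub_nonneg.2 (min_le_left _ _)
  have h1 : 1 - min 1 (ε / K) < 1 := sub_lt_self 1 hd
  -- The minimum with 1 keeps `γ ≥ 0`, and `ε / K` gives `(1 - γ) K ≤ ε`. This error enters twice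
  -- and `(1 - γ) ε ≤ ε` once, whence the factor 3.
  refine ⟨1 - min 1 (ε / K), h0, h1, fun π hN i μ s => ?_⟩
  have hu := (abs_le.1 (h _ h0 h1 (Function.update π i μ) i s)).2
  have hl := (abs_le.1 (h _ h0 h1 π i s)).1
  have hn := mul_le_mul_of_nonneg_left (hN i μ s) (sub_nonneg.2 h1.le)
  rw [sub_sub_cancel] at hu hl hn
  have hk : min 1 (ε / K) * K ≤ ε :=
    (mul_le_mul_of_nonneg_right (min_le_right _ _) hK.le).trans_eq (div_mul_cancel₀ ε hK.ne')
  have he : min 1 (ε / K) * ε ≤ ε := mul_le_of_le_one_left hε.le (min_le_left _ _)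
  rw [mul_add] at hn
  linarith

end RobustMarkovGame

end

theorem mainTheorem3 :
    ∃ C : ℝ, 0 < C ∧
      ∀ (ι S : Type*) (A : ι → Type*)
        [Fintype ι] [DecidableEq ι] [Fintype S] [DecidableEq S] [∀ i, Fintype (A i)]
        (G : RobustMarkovGame ι S A), G.IsRegular →
        (∀ (γ : ℕ → ℝ) (π' : ℕ → JointPolicy S A) (π : JointPolicy S A),
          (∀ t, 0 ≤ γ t ∧ γ t < 1) → Tendsto γ atTop (𝓝 1) →
          (∀ t, G.IsDiscountedNash (γ t) (π' t)) → Tendsto π' atTop (𝓝 π) →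
          G.IsAverageNash π) ∧
        (∀ ε : ℝ, 0 < ε → ∃ γ : ℝ, 0 ≤ γ ∧ γ < 1 ∧
          ∀ π : JointPolicy S A, G.IsDiscountedEpsNash γ ε π → G.IsAverageEpsNash (C * ε) π) := by
  refine ⟨3, by norm_num, fun ι S A _ _ _ _ _ G hG =>
    ⟨fun γ π' π hγ hlim hN hπ => ?_, fun ε hε => ?_⟩⟩
  · exact hG.isAverageNash_of_tendsto hγ hlim hN hπ
  · exact hG.exists_isAverageEpsNash hε
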